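/- Let $X\in\mathbb R^{m\times n}$ have rank $r$, let $\Omega\subseteq[m]\times[n]$ be the set of observed positions, and let $X_\Omega$ agree with $X$ on $\Omega$ and be zero elsewhere; let $x_{\Omega,i}$ be the $i$-th column of $X_\Omega$. Let $\mathcal U_{m,r}=\{U\in\mathbb R^{m\times r}: U^TU=I_r\}$. For $x_{\Omega,i}\neq 0$ let $B_i$ be the matrix whose columns are $x_{\Omega,i}/\|x_{\Omega,i}\|$ and the standard basis vectors $e_k$ with $(k,i)\notin\Omega$, and put $f_{G,i}(U)=1-\lambda_{\max}^2(B_i^TU)$, where $\lambda_{\max}$ is the largest singular value; for $x_{\Omega,i}=0$ put $f_{G,i}(U)=0$. Let $f_G=\sum_{i=1}^n f_{G,i}$ and $\mathcal U_G=\{U\in\mathcal U_{m,r}: f_G(U)=0\}$. Suppose that one of the following holds: 1. (rank one, arbitrary sampling) $r=1$ and $\Omega\subseteq[m]\times[n]$ is arbitrary; 2. (full sampling, arbitrary rank) $\Omega=[m]\times[n]$. Let $U_0$ be drawn from the isotropic distribution on $\mathcal U_{m,r}$, i.e. $U_0$ consists of the first $r$ columns of a Haar-distributed orthogonal $m\times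 m$ matrix. Then with probability one there is a continuous path $U(t)\in\mathcal U_{m,r}$, $t\in[0,1]$, such that $U(0)=U_0$, $U(1)\in\mathcal U_G$, and for every $t\in(0,1)$ the derivative $\frac{d}{dt}f_G(U(t))$ exists and is $\le 0$, with equality if and only if $U_0\in\mathcal U_G$. Moreover, in case 1 the path can be chosen to be the normalized linear interpolation $$U(t)=\frac{(1-t)U(0)+tU(1)}{\|(1-t)U(0)+tU(1)\|_F},\qquad t\in[0,1],$$ and in case 2 it can be chosen so that $\mathrm{span}(U(t))$ is a geodesic of the Grassmann manifold of $r$-dimensional subspaces of $\mathbb R^m$ (with its standard orthogonally invariant Riemannian metric) and $U(t)$ is a horizontal lift of it, i.e. $U(t)^T\dot U(t)=0$. -/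

import Mathlib

open MeasureTheory Matrix

noncomputable section

/-! ## The Stiefel set and its isotropic distribution -/

/-- The set `U_{m,r}` of real `m × r` matrices with orthonormal columns. -/
def stiefel (m r : ℕ) : Set (Matrix (Fin m) (Fin r) ℝ) :=
  {U | Uᵀ * U = 1}

instance matrixMeasurableSpace (m r : ℕ) : MeasurableSpace (Matrix (Fin m) (Fin r) ℝ) :=
  borel _

instance matrixBorelSpace (m r : ℕ) : BorelSpace (Matrix (Fin m) (Fin r) ℝ) := ⟨rfl⟩

/-- The group `U_{m,m}` of real orthogonal `m × m` matrices. -/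
abbrev OrthGroup (m : ℕ) : Type := Matrix.unitaryGroup (Fin m) ℝ

theorem orthGroup_transpose_mul_self {m : ℕ} (Q : OrthGroup m) :
    (Q : Matrix (Fin m) (Fin m) ℝ)ᵀ * (Q : Matrix (Fin m) (Fin m) ℝ) = 1 := by
  have h := Matrix.mem_unitaryGroup_iff'.1 Q.2
  rwa [Matrix.star_eq_conjTranspose, Matrix.conjTranspose_eq_transpose_of_trivial] at h

instance orthGroupCompactSpace (m : ℕ) : CompactSpace (OrthGroup m) := by
  refine isCompact_iff_compactSpace.1
    (?_ : IsCompact (Matrix.unitaryGroup (Fin m) ℝ : Set (Matrix (Fin m) (Fin m) ℝ)))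
  have hK : IsCompact (Set.univ.pi fun _ : Fin m => Set.univ.pi fun _ : Fin m =>
      Set.Icc (-1 : ℝ) 1) :=
    isCompact_univ_pi fun _ => isCompact_univ_pi fun _ => isCompact_Icc
  refine IsCompact.of_isClosed_subset (X := Matrix (Fin m) (Fin m) ℝ) hK isClosed_unitary ?_
  intro U hU i _ j _
  have h := entry_norm_bound_of_unitary (𝕜 := ℝ) hU i j
  rw [Real.norm_eq_abs] at h
  exact abs_le.1 h

/-- The Haar probability measure on the orthogonal group. -/
def orthHaar (m : ℕ) : Measure (OrthGroup m) := Measure.haarMeasure ⊤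

/-- The first `r` columns of an orthogonal `m × m` matrix. -/
def firstColumns {m r : ℕ} (h : r ≤ m) (Q : OrthGroup m) : stiefel m r :=
  ⟨(Q : Matrix (Fin m) (Fin m) ℝ).submatrix id (Fin.castLE h), by
    have hQ := orthGroup_transpose_mul_self Q
    have : ((Q : Matrix (Fin m) (Fin m) ℝ)ᵀ * (Q : Matrix (Fin m) (Fin m) ℝ)).submatrix
        (Fin.castLE h) (Fin.castLE h) = 1 := by
      rw [hQ, Matrix.submatrix_one _ (Fin.castLE_injective h)]
    exact this⟩

/-- The isotropic distribution on `U_{m,r}`: the image of the Haar probability measure of the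
orthogonal group under the map that keeps the first `r` columns. -/
def isotropicMeasure {m r : ℕ} (h : r ≤ m) : Measure (stiefel m r) :=
  (orthHaar m).map (firstColumns h)

theorem continuous_firstColumns {m r : ℕ} (h : r ≤ m) : Continuous (firstColumns h) :=
  Continuous.subtype_mk (Continuous.matrix_submatrix continuous_subtype_val _ _) _

instance isotropicMeasure_isProbabilityMeasure {m r : ℕ} (h : r ≤ m) :
    IsProbabilityMeasure (isotropicMeasure h) := by
  have : IsProbabilityMeasure (orthHaar m) := ⟨by
    have h1 := Measure.haarMeasure_self (K₀ := (⊤ : TopologicalSpace.PositiveCompacts (OrthGroup m)))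
    simpa [orthHaar] using h1⟩
  exact Measure.isProbabilityMeasure_map (continuous_firstColumns h).measurable.aemeasurable

/-- Left multiplication of an element of `U_{m,r}` by an orthogonal matrix. -/
def orthAct {m r : ℕ} (A : OrthGroup m) (U : stiefel m r) : stiefel m r :=
  ⟨(A : Matrix (Fin m) (Fin m) ℝ) * U.1, by
    have hU : U.1ᵀ * U.1 = 1 := U.2
    change ((A : Matrix (Fin m) (Fin m) ℝ) * U.1)ᵀ * ((A : Matrix (Fin m) (Fin m) ℝ) * U.1) = 1
    rw [Matrix.transpose_mul, Matrix.mul_assoc, ← Matrix.mul_assoc _ _ U.1,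
      orthGroup_transpose_mul_self, Matrix.one_mul, hU]⟩

/-- The isotropic distribution is invariant under the orthogonal group. -/
theorem isotropicMeasure_map_orthAct {m r : ℕ} (h : r ≤ m) (A : OrthGroup m) :
    (isotropicMeasure h).map (orthAct A) = isotropicMeasure h := by
  have hact : Continuous (orthAct (r := r) A) :=
    Continuous.subtype_mk (continuous_const.matrix_mul continuous_subtype_val) _
  have hcomp : orthAct A ∘ firstColumns h = firstColumns h ∘ fun Q => A * Q := by
    funext Q
    apply Subtype.ext
    ext i j
    simp [orthAct, firstColumns, Matrix.mul_apply]
  have hfirst := (continuous_firstColumns h).measurable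
  have hmul : Measurable fun Q : OrthGroup m => A * Q := (continuous_const_mul A).measurable
  rw [isotropicMeasure, Measure.map_map hact.measurable hfirst, hcomp,
    ← Measure.map_map hfirst hmul, orthHaar, MeasureTheory.map_mul_left_eq_self]

/-! ## The geometric objective -/

/-- The operator `P_Ω`: entries outside `Ω` are replaced by zero. -/
def observe {m n : ℕ} (Ω : Finset (Fin m × Fin n)) (X : Matrix (Fin m) (Fin n) ℝ) :
    Matrix (Fin m) (Fin n) ℝ :=
  Matrix.of fun k i => if (k, i) ∈ Ω then X k i else 0

/-- The `i`-th column of the observed matrix divided by its Euclidean norm. -/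
def normalizedColumn {m n : ℕ} (Ω : Finset (Fin m × Fin n)) (X : Matrix (Fin m) (Fin n) ℝ)
    (i : Fin n) : Fin m → ℝ :=
  ‖WithLp.toLp 2 ((observe Ω X).col i)‖⁻¹ • (observe Ω X).col i

/-- The matrix `B_i`: its columns are the normalized observed column and the standard basis
vectors `e_k` of the unobserved positions `k` in column `i`. -/
def colFrame {m n : ℕ} (Ω : Finset (Fin m × Fin n)) (X : Matrix (Fin m) (Fin n) ℝ) (i : Fin n) :
    Matrix (Fin m) (Unit ⊕ {k : Fin m // (k, i) ∉ Ω}) ℝ :=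
  Matrix.fromCols (Matrix.replicateCol Unit (normalizedColumn Ω X i))
    ((1 : Matrix (Fin m) (Fin m) ℝ).submatrix id Subtype.val)

/-- The largest singular value of a real matrix. -/
def maxSingularValue {p q : Type*} [Fintype p] [Fintype q] [DecidableEq q]
    (A : Matrix p q ℝ) : ℝ :=
  (Matrix.toEuclideanLin A).singularValues 0

open Classical in
/-- The geometric metric `f_{G,i}` of the `i`-th column. -/
def geomMetricCol {m n r : ℕ} (Ω : Finset (Fin m × Fin n)) (X : Matrix (Fin m) (Fin n) ℝ)
    (i : Fin n) (U : Matrix (Fin m) (Fin r) ℝ) : ℝ :=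
  if (observe Ω X).col i = 0 then 0
  else 1 - maxSingularValue ((colFrame Ω X i)ᵀ * U) ^ 2

/-- The geometric objective `f_G`. -/
def geomObjective {m n r : ℕ} (Ω : Finset (Fin m × Fin n)) (X : Matrix (Fin m) (Fin n) ℝ)
    (U : Matrix (Fin m) (Fin r) ℝ) : ℝ :=
  ∑ i, geomMetricCol Ω X i U

/-- The zero set `U_G ⊆ U_{m,r}` of the geometric objective. -/
def geomZeroSet {m n : ℕ} (r : ℕ) (Ω : Finset (Fin m × Fin n)) (X : Matrix (Fin m) (Fin n) ℝ) :
    Set (Matrix (Fin m) (Fin r) ℝ) :=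
  {U | U ∈ stiefel m r ∧ geomObjective Ω X U = 0}

/-! ## Paths in the Stiefel set, parametrized by `[0, 1]`

A path is a function on `ℝ` of which only the values on `[0, 1]` matter. -/

/-- `U` is a continuous path in `U_{m,r}` from `U₀` into `U_G` with `d/dt f_G ≤ 0` on `(0, 1)`,
where equality holds if and only if `U₀ ∈ U_G`. -/
structure IsDescentPath {m n r : ℕ} (Ω : Finset (Fin m × Fin n)) (X : Matrix (Fin m) (Fin n) ℝ)
    (U₀ : Matrix (Fin m) (Fin r) ℝ) (U : ℝ → Matrix (Fin m) (Fin r) ℝ) : Prop where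
  continuousOn : ContinuousOn U (Set.Icc 0 1)
  mem_stiefel : ∀ t ∈ Set.Icc (0 : ℝ) 1, U t ∈ stiefel m r
  start : U 0 = U₀
  finish : U 1 ∈ geomZeroSet r Ω X
  deriv_nonpos : ∀ t ∈ Set.Ioo (0 : ℝ) 1, ∃ d : ℝ,
    HasDerivAt (fun s => geomObjective Ω X (U s)) d t ∧ d ≤ 0 ∧
      (d = 0 ↔ U₀ ∈ geomZeroSet r Ω X)

/-- The Frobenius norm. -/
def frobNorm {m r : ℕ} (A : Matrix (Fin m) (Fin r) ℝ) : ℝ :=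
  √(∑ i, ∑ j, A i j ^ 2)

/-- `U` is the normalized linear interpolation between its end points. -/
def IsNormalizedInterpolation {m r : ℕ} (U : ℝ → Matrix (Fin m) (Fin r) ℝ) : Prop :=
  ∀ t ∈ Set.Icc (0 : ℝ) 1,
    U t = (frobNorm ((1 - t) • U 0 + t • U 1))⁻¹ • ((1 - t) • U 0 + t • U 1)

/-- `U` is a horizontal lift to `U_{m,r}` of a geodesic `span (U t)`, `t ∈ [0, 1]`, of the
Grassmann manifold with its standard (orthogonally invariant) Riemannian metric.

The tangent space of the Grassmann manifold at `span U` is the space of horizontal vectors `W`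
at `U` (those with `Uᵀ W = 0`) with the Euclidean inner product, and the covariant derivative along
a horizontal curve is the horizontal part `(1 - U Uᵀ) W'` of the ordinary derivative. Hence the
geodesics are the twice differentiable horizontal curves whose acceleration has zero
horizontal part. Derivatives are taken entrywise, one-sided at `0` and `1`. -/
def IsGrassmannGeodesic {m r : ℕ} (U : ℝ → Matrix (Fin m) (Fin r) ℝ) : Prop :=
  ∃ V A : ℝ → Matrix (Fin m) (Fin r) ℝ, ∀ t ∈ Set.Icc (0 : ℝ) 1,
    U t ∈ stiefel m r ∧
    (∀ i j, HasDerivWithinAt (fun s => U s i j) (V t i j) (Set.Icc 0 1) t) ∧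
    (∀ i j, HasDerivWithinAt (fun s => V s i j) (A t i j) (Set.Icc 0 1) t) ∧
    (U t)ᵀ * V t = 0 ∧
    (1 - U t * (U t)ᵀ) * A t = 0

end

/-! ## Singular values of maps of rank at most one -/

/-! In both cases `B_iᵀ U` has rank at most one (a single column if `r = 1`, a single row under full
sampling), so its largest singular value squared is its squared Frobenius norm and the objective
becomes explicit.

Rank one: write `X = p cᵀ` with `p` a unit vector. Then `f_G(u) = ∑ i, ‖R_i u‖²`, where `R_i`
projects onto the complement of the range of `B_i` (or is zero if the observed column vanishes), and
`R_i p = 0` (`colResidual_mulVec_eq_zero`). On the normalized chord from `u` to `p` this gives `f_G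
= (1 - t)² f_G(u) / N(t)`, with `N` the squared length of the chord point; it decreases once the
sign of `p` is chosen with `⟨u, p⟩ ≥ 0`.

Full sampling: `exists_principal_angles` gives angles `θ j ∈ [0, π/2]` between `span U₀` and the
column space of `X`. Turning all of them linearly in `t` is a horizontal geodesic along which `f_G =
∑ j, β j * sin² ((1 - t) θ j)` with `β j ≥ 0` (`geomObjective_angleCurve`), and every term is
nonincreasing.

Both constructions work for every starting point; right angles do no harm because strict descent is
asked only for `0 < t < 1`. -/

/-- The right side is the trace of `T* T`, that is, the sum of all squared singular values; rank at
most one leaves only the one of index `0`. -/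
theorem LinearMap.sq_singularValues_zero_of_finrank_range_le_one {ι E F : Type*} [Fintype ι]
    [NormedAddCommGroup E] [InnerProductSpace ℝ E] [FiniteDimensional ℝ E]
    [NormedAddCommGroup F] [InnerProductSpace ℝ F] [FiniteDimensional ℝ F]
    (T : E →ₗ[ℝ] F) (b : OrthonormalBasis ι ℝ E) (h : Module.finrank ℝ T.range ≤ 1) :
    T.singularValues 0 ^ 2 = ∑ i, ‖T (b i)‖ ^ 2 := by
  have htr := T.isSymmetric_adjoint_comp_self.trace_eq_sum_eigenvalues (𝕜 := ℝ) rfl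
  rw [LinearMap.trace_eq_sum_inner _ b] at htr
  have h1 : ∀ i, inner ℝ (b i) ((LinearMap.adjoint T ∘ₗ T) (b i)) = ‖T (b i)‖ ^ 2 := fun i => by
    rw [LinearMap.comp_apply, LinearMap.adjoint_inner_right, real_inner_self_eq_norm_sq]
  simp only [h1] at htr
  rw [htr]
  simp only [RCLike.ofReal_real_eq_id, id_eq, ← T.sq_singularValues_fin rfl]
  -- In dimension `0` the sum has no index `0` to isolate; there `singularValues 0` is zero by
  -- convention.
  rcases Nat.eq_zero_or_pos (Module.finrank ℝ E) with h0 | hpos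
  · rw [T.singularValues_of_finrank_le h0.le]
    have : IsEmpty (Fin (Module.finrank ℝ E)) := by rw [h0]; infer_instance
    simp
  · rw [Finset.sum_eq_single (⟨0, hpos⟩ : Fin (Module.finrank ℝ E))]
    · intro i _ hi
      have : 1 ≤ (i : ℕ) := Nat.one_le_iff_ne_zero.2 fun h => hi (Fin.ext h)
      rw [T.singularValues_eq_zero_iff_le_finrank_range.2 (h.trans this)]
      simp
    · simp

theorem sq_maxSingularValue_of_rank_le_one {p q : Type*} [Fintype p] [Fintype q] [DecidableEq q]
    (A : Matrix p q ℝ) (hA : A.rank ≤ 1) :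
    maxSingularValue A ^ 2 = ∑ j, ∑ i, A i j ^ 2 := by
  have hrange : Module.finrank ℝ (Matrix.toEuclideanLin A).range = A.rank := by
    rw [Matrix.toEuclideanLin_eq_toLin_orthonormal]
    exact (A.rank_eq_finrank_range_toLin _ _).symm
  rw [maxSingularValue, LinearMap.sq_singularValues_zero_of_finrank_range_le_one _
    (EuclideanSpace.basisFun q ℝ) (hrange ▸ hA)]
  refine Finset.sum_congr rfl fun j _ => ?_
  rw [EuclideanSpace.norm_sq_eq]
  refine Finset.sum_congr rfl fun i _ => ?_
  simp [Matrix.toLpLin_apply, Matrix.mulVec_single]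

/-! ## Orthonormal bases of column spaces -/

theorem exists_stiefel_mul_of_mem {m n r : ℕ} (S : Submodule ℝ (EuclideanSpace ℝ (Fin m)))
    (hS : Module.finrank ℝ S = r) (X : Matrix (Fin m) (Fin n) ℝ)
    (hX : ∀ i, WithLp.toLp 2 (X.col i) ∈ S) :
    ∃ P ∈ stiefel m r, ∃ C : Matrix (Fin r) (Fin n) ℝ, X = P * C := by
  obtain ⟨b⟩ : Nonempty (OrthonormalBasis (Fin r) ℝ S) :=
    ⟨(stdOrthonormalBasis ℝ S).reindex (finCongr hS)⟩
  refine ⟨Matrix.of fun k j => (b j : EuclideanSpace ℝ (Fin m)) k, ?_,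
    Matrix.of fun j i => b.repr ⟨_, hX i⟩ j, ?_⟩
  · ext i j
    have := orthonormal_iff_ite.1 b.orthonormal i j
    rw [Submodule.coe_inner, PiLp.inner_apply] at this
    simpa [Matrix.mul_apply, Matrix.one_apply, mul_comm] using this
  · ext k i
    have h := congrArg (fun z : S => (z : EuclideanSpace ℝ (Fin m)) k) (b.sum_repr ⟨_, hX i⟩)
    simp only [AddSubmonoidClass.coe_finsetSum, SetLike.val_smul, WithLp.ofLp_sum,
      Finset.sum_apply, PiLp.smul_apply, smul_eq_mul, col_apply] at h
    rw [← h, Matrix.mul_apply]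
    exact Finset.sum_congr rfl fun _ _ => mul_comm _ _

theorem exists_stiefel_mul {m n r : ℕ} (X : Matrix (Fin m) (Fin n) ℝ) (hr : X.rank = r) :
    ∃ P ∈ stiefel m r, ∃ C : Matrix (Fin r) (Fin n) ℝ, X = P * C := by
  refine exists_stiefel_mul_of_mem (Matrix.toEuclideanLin X).range ?_ X fun i => ?_
  · rw [← hr, Matrix.toEuclideanLin_eq_toLin_orthonormal]
    exact (X.rank_eq_finrank_range_toLin _ _).symm
  · refine ⟨EuclideanSpace.single i 1, ?_⟩
    ext k
    simp [Matrix.toLpLin_apply, Matrix.mulVec_single]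

/-! ## Principal angles -/

theorem transpose_mul_self_apply_self {p q : Type*} [Fintype p] (M : Matrix p q ℝ) (j : q) :
    (Mᵀ * M) j j = ∑ k, M k j ^ 2 := by
  simp [Matrix.mul_apply, sq]

theorem nonneg_of_transpose_mul_self_eq_diagonal {p q : Type*} [Fintype p] [DecidableEq q]
    {M : Matrix p q ℝ} {d : q → ℝ} (h : Mᵀ * M = diagonal d) (j : q) : 0 ≤ d j := by
  have := transpose_mul_self_apply_self M j
  rw [h, diagonal_apply_eq] at this
  rw [this]
  positivity

theorem eq_zero_of_transpose_mul_self_eq_diagonal {p q : Type*} [Fintype p] [DecidableEq q]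
    {M : Matrix p q ℝ} {d : q → ℝ} (h : Mᵀ * M = diagonal d) {j : q} (hj : d j = 0) (k : p) :
    M k j = 0 := by
  have := transpose_mul_self_apply_self M j
  rw [h, diagonal_apply_eq, hj, eq_comm, Finset.sum_eq_zero_iff_of_nonneg fun _ _ => sq_nonneg _]
    at this
  exact pow_eq_zero_iff two_ne_zero |>.1 (this k (Finset.mem_univ k))

/-- The columns of `M` are orthogonal with squared norms `d j`. The normalized nonzero ones extend
to an orthonormal basis; a column with `d j = 0` vanishes, so any basis vector serves there. -/
theorem exists_orthogonal_mul_diagonal {r : ℕ} (M : Matrix (Fin r) (Fin r) ℝ) (d : Fin r → ℝ)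
    (h : Mᵀ * M = diagonal d) :
    ∃ Y : Matrix (Fin r) (Fin r) ℝ, Yᵀ * Y = 1 ∧ M = Y * diagonal fun j => √(d j) := by
  let v : Fin r → EuclideanSpace ℝ (Fin r) := fun j => (√(d j))⁻¹ • WithLp.toLp 2 (M.col j)
  have hd := nonneg_of_transpose_mul_self_eq_diagonal h
  have hM : ∀ i j, ∑ k, M k i * M k j = if i = j then d i else 0 := fun i j => by
    have := congrFun (congrFun h i) j
    simpa [Matrix.mul_apply, diagonal_apply] using this
  have hv : Orthonormal ℝ (Set.domRestrict {j | d j ≠ 0} v) := by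
    rw [orthonormal_iff_ite]
    rintro ⟨i, hi⟩ ⟨j, hj⟩
    simp only [Set.domRestrict_apply, v, inner_smul_left, inner_smul_right, PiLp.inner_apply]
    have := hM i j
    simp only [Subtype.mk.injEq, RCLike.inner_apply, conj_trivial, col_apply]
    rw [show ∑ k, M k j * M k i = ∑ k, M k i * M k j from
      Finset.sum_congr rfl fun _ _ => mul_comm _ _, this]
    split_ifs with hij
    · subst hij
      have : √(d i) ≠ 0 := (Real.sqrt_ne_zero (hd i)).2 hi
      field_simp
      exact (Real.sq_sqrt (hd i)).symm
    · simp
  obtain ⟨b, hb⟩ := hv.exists_orthonormalBasis_extension_of_card_eq (by simp)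
  refine ⟨Matrix.of fun k j => b j k, ?_, ?_⟩
  · ext i j
    have := orthonormal_iff_ite.1 b.orthonormal i j
    rw [PiLp.inner_apply] at this
    simpa [Matrix.mul_apply, Matrix.one_apply, mul_comm] using this
  · ext k j
    rw [mul_diagonal, of_apply]
    by_cases hj : d j = 0
    · rw [eq_zero_of_transpose_mul_self_eq_diagonal h hj, hj, Real.sqrt_zero, mul_zero]
    · have : √(d j) ≠ 0 := (Real.sqrt_ne_zero (hd j)).2 hj
      rw [hb j hj]
      simp [v]
      field_simp

/-- This is the singular value decomposition of `Uᵀ P`, with singular values `cos θ j`. The part `G`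
of `P Z` orthogonal to `U` has orthogonal columns of norm `sin θ j`, and `W` is `G` with its nonzero
columns normalized. `W` cannot always have orthonormal columns (for instance when `2r > m`), hence
the alternative `e j = 1 ∨ θ j = 0`. -/
theorem exists_principal_angles {m r : ℕ} {U P : Matrix (Fin m) (Fin r) ℝ}
    (hU : U ∈ stiefel m r) (hP : P ∈ stiefel m r) :
    ∃ (Y Z : Matrix (Fin r) (Fin r) ℝ) (W : Matrix (Fin m) (Fin r) ℝ) (e θ : Fin r → ℝ),
      Yᵀ * Y = 1 ∧ Zᵀ * Z = 1 ∧ Uᵀ * W = 0 ∧ Wᵀ * W = diagonal e ∧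
      (∀ j, e j = 1 ∨ θ j = 0) ∧ (∀ j, 0 ≤ θ j ∧ θ j ≤ Real.pi / 2) ∧
      P * Z = U * Y * diagonal (fun j => Real.cos (θ j)) +
        W * diagonal (fun j => Real.sin (θ j)) := by
  have hU' : Uᵀ * U = 1 := hU
  have hP' : Pᵀ * P = 1 := hP
  have hS : ((Uᵀ * P)ᵀ * (Uᵀ * P)).IsHermitian := by
    rw [← conjTranspose_eq_transpose_of_trivial (Uᵀ * P)]
    exact isHermitian_conjTranspose_mul_self _
  let Z : Matrix (Fin r) (Fin r) ℝ := hS.eigenvectorUnitary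
  let d := hS.eigenvalues
  have hZ : Zᵀ * Z = 1 := orthGroup_transpose_mul_self hS.eigenvectorUnitary
  let M := Uᵀ * P * Z
  have hM : Mᵀ * M = diagonal d := by
    have h1 : (Uᵀ * P)ᵀ * (Uᵀ * P) = Z * diagonal d * Zᵀ := by
      have := hS.spectral_theorem
      rw [Unitary.conjStarAlgAut_apply] at this
      exact this
    calc Mᵀ * M = Zᵀ * ((Uᵀ * P)ᵀ * (Uᵀ * P)) * Z := by
          simp only [M, transpose_mul, Matrix.mul_assoc]
      _ = (Zᵀ * Z) * diagonal d * (Zᵀ * Z) := by rw [h1]; simp only [Matrix.mul_assoc]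
      _ = diagonal d := by rw [hZ, Matrix.one_mul, Matrix.mul_one]
  let G := P * Z - U * M
  have hUG : Uᵀ * G = 0 := by
    simp only [G, M, Matrix.mul_sub, ← Matrix.mul_assoc, hU', Matrix.one_mul, sub_self]
  have hG : Gᵀ * G = diagonal fun j => 1 - d j := by
    have h1 : Gᵀ * G = (P * Z)ᵀ * G := by
      have : (U * M)ᵀ * G = 0 := by rw [transpose_mul, Matrix.mul_assoc, hUG, Matrix.mul_zero]
      conv_lhs => enter [1]; rw [show G = P * Z - U * M from rfl, transpose_sub]
      rw [Matrix.sub_mul, this, sub_zero]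
    have h2 : (P * Z)ᵀ * (U * M) = Mᵀ * M := by
      simp only [M, transpose_mul, transpose_transpose, Matrix.mul_assoc]
    have h3 : (P * Z)ᵀ * (P * Z) = 1 := by
      rw [transpose_mul, Matrix.mul_assoc, ← Matrix.mul_assoc Pᵀ, hP', Matrix.one_mul, hZ]
    rw [h1, show G = P * Z - U * M from rfl, Matrix.mul_sub, h2, h3, hM, ← diagonal_one,
      diagonal_sub]
  have hd0 := nonneg_of_transpose_mul_self_eq_diagonal hM
  have hd1 := nonneg_of_transpose_mul_self_eq_diagonal hG
  obtain ⟨Y, hY, hMY⟩ := exists_orthogonal_mul_diagonal M d hM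
  let s : Fin r → ℝ := fun j => √(1 - d j)
  have hs : ∀ j, s j * s j = 1 - d j := fun j => Real.mul_self_sqrt (hd1 j)
  have hcos : ∀ j, Real.cos (Real.arccos √(d j)) = √(d j) := fun j =>
    Real.cos_arccos (by linarith [Real.sqrt_nonneg (d j)])
      (Real.sqrt_le_one.2 (by linarith [hd1 j]))
  have hsin : ∀ j, Real.sin (Real.arccos √(d j)) = s j := fun j => by
    rw [Real.sin_arccos, Real.sq_sqrt (hd0 j)]
  -- Since `0⁻¹ = 0`, the column of `W` is zero wherever `s j = 0`, that is, where `θ j = 0`.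
  refine ⟨Y, Z, G * diagonal fun j => (s j)⁻¹, fun j => (s j)⁻¹ * (1 - d j) * (s j)⁻¹,
    fun j => Real.arccos √(d j), hY, hZ, ?_, ?_, ?_, ?_, ?_⟩
  · rw [← Matrix.mul_assoc, hUG, Matrix.zero_mul]
  · rw [transpose_mul, diagonal_transpose, Matrix.mul_assoc, ← Matrix.mul_assoc Gᵀ, hG,
      diagonal_mul_diagonal, diagonal_mul_diagonal]
    simp only [mul_assoc]
  · intro j
    by_cases hj : d j = 1
    · right; simp [hj]
    · left
      have : s j ≠ 0 := fun h => hj (by have := hs j; rw [h] at this; linarith)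
      beta_reduce
      rw [← hs j]
      field_simp
  · exact fun j => ⟨Real.arccos_nonneg _, Real.arccos_le_pi_div_two.2 (Real.sqrt_nonneg _)⟩
  · simp only [hcos, hsin]
    have hGs : G * (diagonal fun j => (s j)⁻¹) * diagonal s = G := by
      ext k j
      rw [Matrix.mul_assoc, diagonal_mul_diagonal, mul_diagonal]
      by_cases hj : s j = 0
      · rw [eq_zero_of_transpose_mul_self_eq_diagonal hG (by rw [← hs j, hj, mul_zero]) k, zero_mul]
      · rw [inv_mul_cancel₀ hj, mul_one]
    rw [hGs, Matrix.mul_assoc, ← hMY]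
    simp [G]

/-! ## The objective -/

theorem norm_toLp_sq {m : ℕ} (v : Fin m → ℝ) : ‖WithLp.toLp 2 v‖ ^ 2 = v ⬝ᵥ v := by
  rw [EuclideanSpace.norm_sq_eq, dotProduct]
  exact Finset.sum_congr rfl fun k _ => by rw [Real.norm_eq_abs, sq_abs, sq]

theorem dotProduct_normalizedColumn_self {m n : ℕ} {Ω : Finset (Fin m × Fin n)}
    {X : Matrix (Fin m) (Fin n) ℝ} {i : Fin n} (h : (observe Ω X).col i ≠ 0) :
    normalizedColumn Ω X i ⬝ᵥ normalizedColumn Ω X i = 1 := by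
  have h0 : ‖WithLp.toLp 2 ((observe Ω X).col i)‖ ≠ 0 := by simpa using h
  rw [normalizedColumn, smul_dotProduct, dotProduct_smul, ← norm_toLp_sq]
  simp only [smul_eq_mul]
  field_simp

theorem normalizedColumn_of_notMem {m n : ℕ} {Ω : Finset (Fin m × Fin n)}
    {X : Matrix (Fin m) (Fin n) ℝ} {i : Fin n} {k : Fin m} (h : (k, i) ∉ Ω) :
    normalizedColumn Ω X i k = 0 := by
  simp [normalizedColumn, observe, h]

/-- The normalized column is supported on observed positions, hence orthogonal to the unobserved
`e_k`. So `B_i B_iᵀ` is an orthogonal projection. -/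
theorem colFrame_transpose_mul_self {m n : ℕ} {Ω : Finset (Fin m × Fin n)}
    {X : Matrix (Fin m) (Fin n) ℝ} {i : Fin n} (h : (observe Ω X).col i ≠ 0) :
    (colFrame Ω X i)ᵀ * colFrame Ω X i = 1 := by
  ext (a | a) (b | b)
  · have := dotProduct_normalizedColumn_self h
    simpa [colFrame, Matrix.mul_apply, dotProduct] using this
  · simp [colFrame, Matrix.mul_apply, Matrix.one_apply, normalizedColumn_of_notMem b.2]
  · simp [colFrame, Matrix.mul_apply, Matrix.one_apply, normalizedColumn_of_notMem a.2]
  · simp [colFrame, Matrix.mul_apply, Matrix.one_apply, Subtype.ext_iff, eq_comm]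

/-! ### Rank one -/

open Classical in
/-- The projection onto the orthogonal complement of the range of `B_i`, or zero when the observed
column vanishes. -/
noncomputable def colResidual {m n : ℕ} (Ω : Finset (Fin m × Fin n)) (X : Matrix (Fin m) (Fin n) ℝ)
    (i : Fin n) : Matrix (Fin m) (Fin m) ℝ :=
  if (observe Ω X).col i = 0 then 0 else 1 - colFrame Ω X i * (colFrame Ω X i)ᵀ

/-- The sum of squared distances of a vector to the ranges of the `B_i`. -/
noncomputable def sumSqResidual {m n : ℕ} (Ω : Finset (Fin m × Fin n))
    (X : Matrix (Fin m) (Fin n) ℝ) (u : Fin m → ℝ) : ℝ :=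
  ∑ i, (colResidual Ω X i *ᵥ u) ⬝ᵥ (colResidual Ω X i *ᵥ u)

theorem sumSqResidual_nonneg {m n : ℕ} (Ω : Finset (Fin m × Fin n))
    (X : Matrix (Fin m) (Fin n) ℝ) (u : Fin m → ℝ) : 0 ≤ sumSqResidual Ω X u :=
  Finset.sum_nonneg fun _ _ => Finset.sum_nonneg fun _ _ => mul_self_nonneg _

theorem sumSqResidual_smul {m n : ℕ} (Ω : Finset (Fin m × Fin n))
    (X : Matrix (Fin m) (Fin n) ℝ) (a : ℝ) (u : Fin m → ℝ) :
    sumSqResidual Ω X (a • u) = a ^ 2 * sumSqResidual Ω X u := by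
  rw [sumSqResidual, sumSqResidual, Finset.mul_sum]
  refine Finset.sum_congr rfl fun i _ => ?_
  rw [mulVec_smul, smul_dotProduct, dotProduct_smul, smul_eq_mul, smul_eq_mul]
  ring

theorem sumSqResidual_add {m n : ℕ} (Ω : Finset (Fin m × Fin n))
    (X : Matrix (Fin m) (Fin n) ℝ) (u v : Fin m → ℝ) (hv : ∀ i, colResidual Ω X i *ᵥ v = 0) :
    sumSqResidual Ω X (u + v) = sumSqResidual Ω X u := by
  simp only [sumSqResidual, mulVec_add, hv, add_zero]

theorem stiefel_one_iff {m : ℕ} {U : Matrix (Fin m) (Fin 1) ℝ} :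
    U ∈ stiefel m 1 ↔ U.col 0 ⬝ᵥ U.col 0 = 1 := by
  change Uᵀ * U = 1 ↔ _
  rw [← Matrix.ext_iff]
  simp [Matrix.mul_apply, dotProduct]

/-- Pythagoras: `‖u‖ = 1` and `λ_max² = ‖Bᵀ u‖² = ‖B Bᵀ u‖²`, so the metric is the squared norm of
`u - B Bᵀ u`. -/
theorem geomMetricCol_eq_of_rank_one {m n : ℕ} (Ω : Finset (Fin m × Fin n))
    (X : Matrix (Fin m) (Fin n) ℝ) (i : Fin n) {U : Matrix (Fin m) (Fin 1) ℝ}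
    (hU : U ∈ stiefel m 1) :
    geomMetricCol Ω X i U = (colResidual Ω X i *ᵥ U.col 0) ⬝ᵥ (colResidual Ω X i *ᵥ U.col 0) := by
  rw [geomMetricCol, colResidual]
  split_ifs with h
  · simp
  set B := colFrame Ω X i with hB
  have hBB : Bᵀ * B = 1 := colFrame_transpose_mul_self h
  rw [sq_maxSingularValue_of_rank_le_one (Bᵀ * U) (by simpa using rank_le_card_width (Bᵀ * U))]
  have h1 : ∑ j, ∑ c, (Bᵀ * U) c j ^ 2 = (Bᵀ *ᵥ U.col 0) ⬝ᵥ (Bᵀ *ᵥ U.col 0) := by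
    simp [dotProduct, Matrix.mul_apply, mulVec, sq]
  have h2 : ∀ w, U.col 0 ⬝ᵥ (B *ᵥ w) = (Bᵀ *ᵥ U.col 0) ⬝ᵥ w := fun w => by
    rw [dotProduct_mulVec, mulVec_transpose]
  have h3 : ∀ w w', (B *ᵥ w) ⬝ᵥ (B *ᵥ w') = w ⬝ᵥ w' := fun w w' => by
    rw [dotProduct_mulVec, ← mulVec_transpose, mulVec_mulVec, hBB, one_mulVec]
  rw [h1, sub_mulVec, one_mulVec, ← mulVec_mulVec, sub_dotProduct, dotProduct_sub, dotProduct_sub,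
    h3, dotProduct_comm (B *ᵥ _), h2, stiefel_one_iff.1 hU]
  ring

theorem geomObjective_eq_of_rank_one {m n : ℕ} (Ω : Finset (Fin m × Fin n))
    (X : Matrix (Fin m) (Fin n) ℝ) {U : Matrix (Fin m) (Fin 1) ℝ} (hU : U ∈ stiefel m 1) :
    geomObjective Ω X U = sumSqResidual Ω X (U.col 0) :=
  Finset.sum_congr rfl fun i _ => geomMetricCol_eq_of_rank_one Ω X i hU

/-- The vector `p` lies in the range of every `B_i` whose observed column is nonzero: on observed
positions it is proportional to that column, and elsewhere the `e_k` supply its entries. -/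
theorem colResidual_mulVec_eq_zero {m n : ℕ} (Ω : Finset (Fin m × Fin n))
    (P : Matrix (Fin m) (Fin 1) ℝ) (C : Matrix (Fin 1) (Fin n) ℝ) (i : Fin n) :
    colResidual Ω (P * C) i *ᵥ P.col 0 = 0 := by
  rw [colResidual]
  split_ifs with h
  · simp
  set B := colFrame Ω (P * C) i with hB
  have hobs : ∀ k, (observe Ω (P * C)).col i k = if (k, i) ∈ Ω then P k 0 * C 0 i else 0 := by
    intro k
    simp [observe, Matrix.mul_apply]
  have hC : C 0 i ≠ 0 := fun h0 => h <| by
    funext k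
    rw [hobs, h0]
    simp
  have hN : ‖WithLp.toLp 2 ((observe Ω (P * C)).col i)‖ ≠ 0 := by simpa using h
  have hBB : Bᵀ * B = 1 := colFrame_transpose_mul_self h
  -- On observed positions `p_k = x_k / C 0 i`, and `x` is its norm times the first column of `B`.
  have hP : P.col 0 = B *ᵥ Sum.elim
      (fun _ => ‖WithLp.toLp 2 ((observe Ω (P * C)).col i)‖ * (C 0 i)⁻¹) (fun k => P k.1 0) := by
    funext k
    have h1 : ∑ x : {k : Fin m // (k, i) ∉ Ω}, (1 : Matrix (Fin m) (Fin m) ℝ) k x * P x 0 =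
        if (k, i) ∈ Ω then 0 else P k 0 := by
      split_ifs with hk
      · refine Finset.sum_eq_zero fun x _ => ?_
        rw [Matrix.one_apply_ne fun h : k = x.1 => x.2 (h ▸ hk), zero_mul]
      · rw [Finset.sum_eq_single (⟨k, hk⟩ : {k : Fin m // (k, i) ∉ Ω})]
        · simp
        · intro x _ hx
          rw [Matrix.one_apply_ne fun h => hx (Subtype.ext h.symm), zero_mul]
        · simp
    have h2 : ((1 : Matrix (Fin m) (Fin m) ℝ).submatrix id
        (Subtype.val : {k : Fin m // (k, i) ∉ Ω} → Fin m) *ᵥ fun k => P k.1 0) k =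
        if (k, i) ∈ Ω then 0 else P k 0 := h1
    rw [hB, colFrame, fromCols_mulVec_sumElim, Pi.add_apply, h2]
    simp only [mulVec, dotProduct, replicateCol_apply, Finset.univ_unique, Finset.sum_const,
      Finset.card_singleton, one_smul, normalizedColumn, Pi.smul_apply, smul_eq_mul, hobs,
      col_apply]
    split_ifs with hk
    · field_simp
      simp
    · simp
  rw [hP, sub_mulVec, one_mulVec, mulVec_mulVec, Matrix.mul_assoc, hBB, Matrix.mul_one, sub_self]

/-! ### Descent along the normalized chord -/

theorem frobNorm_one {m : ℕ} (A : Matrix (Fin m) (Fin 1) ℝ) :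
    frobNorm A = √(A.col 0 ⬝ᵥ A.col 0) := by
  simp [frobNorm, dotProduct, sq]

/-- The residuals annihilate `p`, so on the chord only the factor `(1 - t)²` and the normalization
`N t` vary. The sign condition `hc` keeps the chord away from the origin and fixes the sign of the
derivative. -/
theorem exists_descent_interpolation {m n : ℕ} (Ω : Finset (Fin m × Fin n))
    (P : Matrix (Fin m) (Fin 1) ℝ) (C : Matrix (Fin 1) (Fin n) ℝ) (hP : P ∈ stiefel m 1)
    {U₀ : Matrix (Fin m) (Fin 1) ℝ} (hU₀ : U₀ ∈ stiefel m 1)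
    (hc : 0 ≤ U₀.col 0 ⬝ᵥ P.col 0) :
    ∃ U : ℝ → Matrix (Fin m) (Fin 1) ℝ,
      IsDescentPath Ω (P * C) U₀ U ∧ IsNormalizedInterpolation U := by
  set u := U₀.col 0 with hu
  set p := P.col 0 with hp
  set c := u ⬝ᵥ p with hcdef
  have huu : u ⬝ᵥ u = 1 := stiefel_one_iff.1 hU₀
  have hpp : p ⬝ᵥ p = 1 := stiefel_one_iff.1 hP
  have hpu : p ⬝ᵥ u = c := dotProduct_comm _ _
  have hker : ∀ i, colResidual Ω (P * C) i *ᵥ p = 0 := colResidual_mulVec_eq_zero Ω P C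
  set q := sumSqResidual Ω (P * C) u with hq
  have hq0 : 0 ≤ q := sumSqResidual_nonneg _ _ _
  let L : ℝ → Matrix (Fin m) (Fin 1) ℝ := fun t => (1 - t) • U₀ + t • P
  let N : ℝ → ℝ := fun t => (1 - t) ^ 2 + t ^ 2 + 2 * (t * (1 - t)) * c
  let U : ℝ → Matrix (Fin m) (Fin 1) ℝ := fun t => (frobNorm (L t))⁻¹ • L t
  have hLcol : ∀ t, (L t).col 0 = (1 - t) • u + t • p := fun t => rfl
  have hUcol : ∀ t, (U t).col 0 = (frobNorm (L t))⁻¹ • (L t).col 0 := fun t => rfl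
  have hLN : ∀ t, (L t).col 0 ⬝ᵥ (L t).col 0 = N t := fun t => by
    rw [hLcol]
    simp only [add_dotProduct, dotProduct_add, smul_dotProduct, dotProduct_smul, huu, hpp, hpu,
      ← hcdef, smul_eq_mul, N]
    ring
  have hfrob : ∀ t, frobNorm (L t) = √(N t) := fun t => by rw [frobNorm_one, hLN]
  have hNpos : ∀ t ∈ Set.Icc (0 : ℝ) 1, 0 < N t := fun t ht => by
    have h1 : 0 ≤ 2 * (t * (1 - t)) * c :=
      mul_nonneg (mul_nonneg two_pos.le (mul_nonneg ht.1 (sub_nonneg.2 ht.2))) hc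
    have h2 : 0 < (1 - t) ^ 2 + t ^ 2 := by nlinarith [sq_nonneg (1 - 2 * t)]
    exact add_pos_of_pos_of_nonneg h2 h1
  have hmem : ∀ t ∈ Set.Icc (0 : ℝ) 1, U t ∈ stiefel m 1 := fun t ht => by
    have := Real.mul_self_sqrt (hNpos t ht).le
    have h0 : √(N t) ≠ 0 := (Real.sqrt_pos.2 (hNpos t ht)).ne'
    rw [stiefel_one_iff, hUcol, smul_dotProduct, dotProduct_smul, hLN, hfrob, smul_eq_mul,
      smul_eq_mul]
    nth_rewrite 3 [← this]
    field_simp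
  have hL0 : L 0 = U₀ := by simp [L]
  have hL1 : L 1 = P := by simp [L]
  have hU0 : U 0 = U₀ := by
    simp only [U, hfrob, hL0]
    simp [N]
  have hU1 : U 1 = P := by
    simp only [U, hfrob, hL1]
    simp [N]
  have hobj : ∀ t ∈ Set.Icc (0 : ℝ) 1,
      geomObjective Ω (P * C) (U t) = (1 - t) ^ 2 * q / N t := fun t ht => by
    rw [geomObjective_eq_of_rank_one Ω _ (hmem t ht), hUcol, sumSqResidual_smul, hLcol,
      sumSqResidual_add _ _ _ _ fun i => by rw [mulVec_smul, hker, smul_zero], sumSqResidual_smul,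
      hfrob, inv_pow, Real.sq_sqrt (hNpos t ht).le]
    ring
  have hiff : U₀ ∈ geomZeroSet 1 Ω (P * C) ↔ q = 0 := by
    rw [geomZeroSet, Set.mem_ofPred_eq, geomObjective_eq_of_rank_one Ω _ hU₀]
    exact and_iff_right hU₀
  have hNcont : Continuous N := by fun_prop
  refine ⟨U, ⟨?_, hmem, hU0, ?_, ?_⟩, ?_⟩
  · have hL : Continuous L := by fun_prop
    refine ContinuousOn.smul (f := fun t => (frobNorm (L t))⁻¹) (ContinuousOn.inv₀ ?_ ?_)
      hL.continuousOn
    · simp only [hfrob]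
      exact hNcont.sqrt.continuousOn
    · intro t ht
      rw [hfrob]
      exact (Real.sqrt_pos.2 (hNpos t ht)).ne'
  · refine ⟨hmem 1 (by simp), ?_⟩
    rw [hobj 1 (by simp)]
    simp
  · intro t ht
    have ht' : t ∈ Set.Icc (0 : ℝ) 1 := Set.Ioo_subset_Icc_self ht
    have hN := hNpos t ht'
    have hN' : HasDerivAt N (-2 * (1 - t) + 2 * t + 2 * (1 - 2 * t) * c) t := by
      have h1 := (hasDerivAt_id t).const_sub 1
      have h2 := ((h1.pow 2).add ((hasDerivAt_id t).pow 2)).add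
        ((((hasDerivAt_id t).mul h1).const_mul 2).mul_const c)
      refine HasDerivAt.congr_deriv h2 ?_
      simp only [id, Nat.cast_ofNat, Nat.add_one_sub_one, pow_one]
      ring
    have hnum : HasDerivAt (fun s : ℝ => (1 - s) ^ 2 * q) (-2 * (1 - t) * q) t := by
      refine HasDerivAt.congr_deriv
        ((((hasDerivAt_id t).const_sub 1).pow 2).mul_const q) ?_
      simp
    -- The quotient rule applied to `(1 - t)² q / N t` gives `-q` times this factor; `t > 0` makes
    -- it positive even when `c = 0`.
    have hpos : 0 < 2 * (1 - t) * (t + c * (1 - t)) / N t ^ 2 := by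
      have h1 : 0 < 1 - t := sub_pos.2 ht.2
      have h2 : 0 < t + c * (1 - t) := add_pos_of_pos_of_nonneg ht.1 (mul_nonneg hc h1.le)
      positivity
    refine ⟨-(2 * (1 - t) * (t + c * (1 - t)) / N t ^ 2 * q), ?_, ?_, ?_⟩
    · refine ((hnum.div hN' hN.ne').congr_deriv ?_).congr_of_eventuallyEq ?_
      · rw [div_mul_eq_mul_div, ← neg_div]
        congr 1
        simp only [N]
        ring
      · filter_upwards [Ioo_mem_nhds ht.1 ht.2] with s hs
        exact hobj s (Set.Ioo_subset_Icc_self hs)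
    · exact neg_nonpos.2 (mul_nonneg hpos.le hq0)
    · rw [hiff, neg_eq_zero, mul_eq_zero, or_iff_right hpos.ne']
  · intro t _
    rw [hU0, hU1]

theorem exists_descent_interpolation_of_rank_eq_one {m n : ℕ} (Ω : Finset (Fin m × Fin n))
    (X : Matrix (Fin m) (Fin n) ℝ) (hX : X.rank = 1) {U₀ : Matrix (Fin m) (Fin 1) ℝ}
    (hU₀ : U₀ ∈ stiefel m 1) :
    ∃ U : ℝ → Matrix (Fin m) (Fin 1) ℝ,
      IsDescentPath Ω X U₀ U ∧ IsNormalizedInterpolation U := by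
  obtain ⟨P, hP, C, rfl⟩ := exists_stiefel_mul X hX
  rcases le_total 0 (U₀.col 0 ⬝ᵥ P.col 0) with h | h
  · exact exists_descent_interpolation Ω P C hP hU₀ h
  -- The unit vector spanning the column space is determined only up to sign, so the inner product
  -- can be made nonnegative.
  · rw [show P * C = -P * -C by rw [Matrix.neg_mul, Matrix.mul_neg, neg_neg]]
    refine exists_descent_interpolation Ω (-P) (-C) ?_ hU₀ ?_
    · rw [stiefel_one_iff] at hP ⊢
      rw [show (-P).col 0 = -P.col 0 from rfl, neg_dotProduct_neg, hP]
    · rw [show (-P).col 0 = -P.col 0 from rfl, dotProduct_neg]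
      exact neg_nonneg.2 h

/-! ## Full sampling -/

theorem geomMetricCol_univ {m n r : ℕ} (X : Matrix (Fin m) (Fin n) ℝ) (i : Fin n)
    (h : (observe Finset.univ X).col i ≠ 0) (U : Matrix (Fin m) (Fin r) ℝ) :
    geomMetricCol Finset.univ X i U =
      1 - (Uᵀ *ᵥ normalizedColumn Finset.univ X i) ⬝ᵥ
        (Uᵀ *ᵥ normalizedColumn Finset.univ X i) := by
  have : IsEmpty {k : Fin m // (k, i) ∉ Finset.univ} := ⟨fun k => k.2 (Finset.mem_univ _)⟩
  rw [geomMetricCol, if_neg h, sq_maxSingularValue_of_rank_le_one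
    ((colFrame Finset.univ X i)ᵀ * U) ((rank_le_card_height _).trans (by simp))]
  congr 1
  rw [dotProduct]
  refine Finset.sum_congr rfl fun j _ => ?_
  simp [Fintype.sum_sum_type, colFrame, Matrix.mul_apply, mulVec, dotProduct, sq, mul_comm]

theorem observe_univ {m n : ℕ} (X : Matrix (Fin m) (Fin n) ℝ) : observe Finset.univ X = X := by
  ext k i
  simp [observe]

/-! ### Curves in the Stiefel set along principal angles -/

/-- The matrix with columns `a j • A j + b j • W j`, written in the basis `Y`. -/
def bend {m r : ℕ} (A W : Matrix (Fin m) (Fin r) ℝ) (Y : Matrix (Fin r) (Fin r) ℝ)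
    (a b : Fin r → ℝ) : Matrix (Fin m) (Fin r) ℝ :=
  (A * diagonal a + W * diagonal b) * Yᵀ

theorem bend_apply {m r : ℕ} (A W : Matrix (Fin m) (Fin r) ℝ) (Y : Matrix (Fin r) (Fin r) ℝ)
    (a b : Fin r → ℝ) (i : Fin m) (j : Fin r) :
    bend A W Y a b i j = ∑ l, (A i l * a l + W i l * b l) * Y j l := by
  rw [bend, Matrix.mul_apply]
  simp only [Matrix.add_apply, mul_diagonal, transpose_apply]

theorem transpose_bend_mul_bend {m r : ℕ} {A W : Matrix (Fin m) (Fin r) ℝ}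
    {Y : Matrix (Fin r) (Fin r) ℝ} {e : Fin r → ℝ} (hA : Aᵀ * A = 1) (hAW : Aᵀ * W = 0)
    (hW : Wᵀ * W = diagonal e) (a b a' b' : Fin r → ℝ) :
    (bend A W Y a b)ᵀ * bend A W Y a' b' =
      Y * diagonal (fun j => a j * a' j + b j * (e j * b' j)) * Yᵀ := by
  have hWA : Wᵀ * A = 0 := by
    rw [← transpose_transpose A, ← transpose_mul, hAW, transpose_zero]
  have key : (A * diagonal a + W * diagonal b)ᵀ * (A * diagonal a' + W * diagonal b') =
      diagonal fun j => a j * a' j + b j * (e j * b' j) := by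
    simp only [transpose_add, transpose_mul, diagonal_transpose, Matrix.add_mul, Matrix.mul_add,
      Matrix.mul_assoc]
    simp only [← Matrix.mul_assoc Aᵀ, ← Matrix.mul_assoc Wᵀ, hA, hAW, hW, hWA, Matrix.one_mul,
      Matrix.zero_mul, Matrix.mul_zero, add_zero, zero_add, diagonal_mul_diagonal, diagonal_add]
  rw [bend, bend, transpose_mul, transpose_transpose, Matrix.mul_assoc, ← Matrix.mul_assoc _ _ Yᵀ,
    key, Matrix.mul_assoc]

/-- Used to write the acceleration of `angleCurve` as the curve itself times an `r × r` matrix. -/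
theorem bend_mul {m r : ℕ} {A W : Matrix (Fin m) (Fin r) ℝ} {Y : Matrix (Fin r) (Fin r) ℝ}
    (hY : Yᵀ * Y = 1) (a b d : Fin r → ℝ) :
    bend A W Y a b * (Y * diagonal d * Yᵀ) = bend A W Y (fun j => a j * d j)
      (fun j => b j * d j) := by
  rw [bend, bend, Matrix.mul_assoc, ← Matrix.mul_assoc Yᵀ, ← Matrix.mul_assoc Yᵀ, hY,
    Matrix.one_mul, ← Matrix.mul_assoc, Matrix.add_mul, Matrix.mul_assoc, Matrix.mul_assoc,
    diagonal_mul_diagonal, diagonal_mul_diagonal]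

theorem hasDerivAt_bend {m r : ℕ} (A W : Matrix (Fin m) (Fin r) ℝ)
    (Y : Matrix (Fin r) (Fin r) ℝ) {a b : ℝ → Fin r → ℝ} {a' b' : Fin r → ℝ} {t : ℝ}
    (ha : ∀ l, HasDerivAt (fun s => a s l) (a' l) t)
    (hb : ∀ l, HasDerivAt (fun s => b s l) (b' l) t) (i : Fin m) (j : Fin r) :
    HasDerivAt (fun s => bend A W Y (a s) (b s) i j) (bend A W Y a' b' i j) t := by
  simp only [bend_apply]
  exact HasDerivAt.fun_sum fun l _ =>
    (((ha l).const_mul _).add ((hb l).const_mul _)).mul_const _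

theorem hasDerivAt_cos_mul (θ t : ℝ) :
    HasDerivAt (fun s => Real.cos (s * θ)) (-(θ * Real.sin (t * θ))) t := by
  refine (((hasDerivAt_id t).mul_const θ).cos).congr_deriv ?_
  simp only [id, one_mul]
  ring

theorem hasDerivAt_sin_mul (θ t : ℝ) :
    HasDerivAt (fun s => Real.sin (s * θ)) (θ * Real.cos (t * θ)) t := by
  refine (((hasDerivAt_id t).mul_const θ).sin).congr_deriv ?_
  simp only [id, one_mul]
  ring

/-- The curve that starts at `A * Yᵀ` and turns the `j`-th column of `A` towards the `j`-th column
of `W` at the angular velocity `θ j`. -/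
noncomputable def angleCurve {m r : ℕ} (A W : Matrix (Fin m) (Fin r) ℝ)
    (Y : Matrix (Fin r) (Fin r) ℝ) (θ : Fin r → ℝ) (t : ℝ) : Matrix (Fin m) (Fin r) ℝ :=
  bend A W Y (fun j => Real.cos (t * θ j)) (fun j => Real.sin (t * θ j))

section AngleCurve

variable {m r : ℕ} {A W : Matrix (Fin m) (Fin r) ℝ} {Y : Matrix (Fin r) (Fin r) ℝ}
  {e θ : Fin r → ℝ}

/-- The subtraction formula for the cosine, column by column; where `e j` may differ from `1` the
angle is zero and the sine term vanishes. -/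
theorem transpose_angleCurve_mul_angleCurve (hA : Aᵀ * A = 1) (hAW : Aᵀ * W = 0)
    (hW : Wᵀ * W = diagonal e) (he : ∀ j, e j = 1 ∨ θ j = 0) (s t : ℝ) :
    (angleCurve A W Y θ s)ᵀ * angleCurve A W Y θ t =
      Y * diagonal (fun j => Real.cos ((t - s) * θ j)) * Yᵀ := by
  rw [angleCurve, angleCurve, transpose_bend_mul_bend hA hAW hW]
  congr 3
  funext j
  rcases he j with h | h
  · rw [h, sub_mul, Real.cos_sub]
    ring
  · simp [h]

theorem angleCurve_mem_stiefel (hA : Aᵀ * A = 1) (hAW : Aᵀ * W = 0)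
    (hW : Wᵀ * W = diagonal e) (he : ∀ j, e j = 1 ∨ θ j = 0) (hY : Yᵀ * Y = 1) (t : ℝ) :
    angleCurve A W Y θ t ∈ stiefel m r := by
  change (angleCurve A W Y θ t)ᵀ * angleCurve A W Y θ t = 1
  rw [transpose_angleCurve_mul_angleCurve hA hAW hW he]
  simpa using mul_eq_one_comm.1 hY

theorem continuous_angleCurve : Continuous (angleCurve A W Y θ) := by
  refine continuous_matrix fun i j => ?_
  simp only [angleCurve, bend_apply]
  fun_prop

theorem isGrassmannGeodesic_angleCurve (hA : Aᵀ * A = 1) (hAW : Aᵀ * W = 0)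
    (hW : Wᵀ * W = diagonal e) (he : ∀ j, e j = 1 ∨ θ j = 0) (hY : Yᵀ * Y = 1) :
    IsGrassmannGeodesic (angleCurve A W Y θ) := by
  refine ⟨fun t => bend A W Y (fun j => -(θ j * Real.sin (t * θ j)))
    (fun j => θ j * Real.cos (t * θ j)), fun t => bend A W Y
    (fun j => Real.cos (t * θ j) * -θ j ^ 2) (fun j => Real.sin (t * θ j) * -θ j ^ 2),
    fun t _ => ⟨angleCurve_mem_stiefel hA hAW hW he hY t, fun i j => ?_, fun i j => ?_, ?_, ?_⟩⟩
  · exact (hasDerivAt_bend A W Y (fun l => hasDerivAt_cos_mul (θ l) t)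
      (fun l => hasDerivAt_sin_mul (θ l) t) i j).hasDerivWithinAt
  · refine (hasDerivAt_bend A W Y (fun l => ?_) (fun l => ?_) i j).hasDerivWithinAt
    · refine ((hasDerivAt_sin_mul (θ l) t).const_mul (θ l)).neg.congr_deriv ?_
      ring
    · refine ((hasDerivAt_cos_mul (θ l) t).const_mul (θ l)).congr_deriv ?_
      ring
  · rw [angleCurve, transpose_bend_mul_bend hA hAW hW]
    have : (fun j => Real.cos (t * θ j) * -(θ j * Real.sin (t * θ j)) +
        Real.sin (t * θ j) * (e j * (θ j * Real.cos (t * θ j)))) = 0 := by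
      funext j
      rcases he j with h | h
      · rw [h, Pi.zero_apply]
        ring
      · simp [h]
    rw [this]
    simp
  · have hmem : (angleCurve A W Y θ t)ᵀ * angleCurve A W Y θ t = 1 :=
      angleCurve_mem_stiefel hA hAW hW he hY t
    beta_reduce
    -- The acceleration is `U t * (Y * diagonal (-θ²) * Yᵀ)`, which the horizontal projection `1 - U
    -- Uᵀ` annihilates.
    rw [← bend_mul hY (fun j => Real.cos (t * θ j)) (fun j => Real.sin (t * θ j))
      (fun j => -θ j ^ 2), ← angleCurve, ← Matrix.mul_assoc, Matrix.sub_mul, Matrix.one_mul,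
      Matrix.mul_assoc (angleCurve A W Y θ t), hmem, Matrix.mul_one, sub_self, Matrix.zero_mul]

/-- A normalized column is `U(1) γ` with `Yᵀ γ` a unit vector. Its metric is therefore `1 - ∑ j,
cos² ((1 - t) θ j) (Yᵀ γ)_j²`, and each nonzero column contributes `(Yᵀ γ)_j²` to `β j`. -/
theorem geomObjective_angleCurve {n : ℕ} (hA : Aᵀ * A = 1) (hAW : Aᵀ * W = 0)
    (hW : Wᵀ * W = diagonal e) (he : ∀ j, e j = 1 ∨ θ j = 0) (hY : Yᵀ * Y = 1)
    (X : Matrix (Fin m) (Fin n) ℝ) (C : Matrix (Fin r) (Fin n) ℝ)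
    (hX : X = angleCurve A W Y θ 1 * C) :
    ∃ β : Fin r → ℝ, (∀ j, 0 ≤ β j) ∧ ∀ t, geomObjective Finset.univ X (angleCurve A W Y θ t) =
      ∑ j, β j * Real.sin ((1 - t) * θ j) ^ 2 := by
  suffices H : ∀ i, ∃ β : Fin r → ℝ, (∀ j, 0 ≤ β j) ∧
      ∀ t, geomMetricCol Finset.univ X i (angleCurve A W Y θ t) =
        ∑ j, β j * Real.sin ((1 - t) * θ j) ^ 2 by
    choose β hβ h using H
    refine ⟨fun j => ∑ i, β i j, fun j => Finset.sum_nonneg fun i _ => hβ i j, fun t => ?_⟩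
    simp only [geomObjective, h, Finset.sum_mul]
    exact Finset.sum_comm
  intro i
  by_cases h : (observe Finset.univ X).col i = 0
  · exact ⟨0, fun _ => le_rfl, fun t => by simp [geomMetricCol, h]⟩
  obtain ⟨γ, hγ⟩ : ∃ γ, normalizedColumn Finset.univ X i = angleCurve A W Y θ 1 *ᵥ γ := by
    refine ⟨‖WithLp.toLp 2 ((observe Finset.univ X).col i)‖⁻¹ • C.col i, ?_⟩
    rw [mulVec_smul, normalizedColumn, observe_univ]
    congr 1
    rw [hX]
    rfl
  have hnorm : ∀ t, (angleCurve A W Y θ t)ᵀ *ᵥ normalizedColumn Finset.univ X i =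
      Y *ᵥ fun j => Real.cos ((1 - t) * θ j) * (Yᵀ *ᵥ γ) j := fun t => by
    rw [hγ, mulVec_mulVec, transpose_angleCurve_mul_angleCurve hA hAW hW he, ← mulVec_mulVec,
      ← mulVec_mulVec]
    congr 1
    funext j
    rw [mulVec_diagonal]
  have hYdot : ∀ w w', (Y *ᵥ w) ⬝ᵥ (Y *ᵥ w') = w ⬝ᵥ w' := fun w w' => by
    rw [dotProduct_mulVec, ← mulVec_transpose, mulVec_mulVec, hY, one_mulVec]
  have hone : (Yᵀ *ᵥ γ) ⬝ᵥ (Yᵀ *ᵥ γ) = 1 := by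
    have h1 := dotProduct_normalizedColumn_self h
    have hU1 : (angleCurve A W Y θ 1)ᵀ * angleCurve A W Y θ 1 = 1 :=
      angleCurve_mem_stiefel hA hAW hW he hY 1
    rw [hγ, dotProduct_mulVec, ← mulVec_transpose, mulVec_mulVec, hU1, one_mulVec] at h1
    rw [← hYdot, mulVec_mulVec, mul_eq_one_comm.1 hY, one_mulVec, h1]
  refine ⟨fun j => (Yᵀ *ᵥ γ) j ^ 2, fun j => sq_nonneg _, fun t => ?_⟩
  rw [geomMetricCol_univ X i h, hnorm, hYdot, ← hone, dotProduct, dotProduct,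
    ← Finset.sum_sub_distrib]
  refine Finset.sum_congr rfl fun j _ => ?_
  rw [Real.sin_sq]
  ring

end AngleCurve

/-! ### Descent along the geodesic -/

theorem hasDerivAt_sum_mul_sin_sq {r : ℕ} (β θ : Fin r → ℝ) (t : ℝ) :
    HasDerivAt (fun s => ∑ j, β j * Real.sin ((1 - s) * θ j) ^ 2)
      (-∑ j, β j * (2 * θ j * Real.sin ((1 - t) * θ j) * Real.cos ((1 - t) * θ j))) t := by
  rw [← Finset.sum_neg_distrib]
  refine HasDerivAt.fun_sum fun j _ => ?_
  refine (((((hasDerivAt_id t).const_sub 1).mul_const (θ j)).sin.pow 2).const_mul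
    (β j)).congr_deriv ?_
  simp only [id, Nat.cast_ofNat, Nat.add_one_sub_one, pow_one]
  ring

/-- The derivative at an interior time and the initial value `f_G(U₀)` vanish under the same
condition: `β j = 0` or `θ j = 0` for every `j`. -/
theorem exists_descent_geodesic {m n r : ℕ} (X : Matrix (Fin m) (Fin n) ℝ) (hX : X.rank = r)
    {U₀ : Matrix (Fin m) (Fin r) ℝ} (hU₀ : U₀ ∈ stiefel m r) :
    ∃ U : ℝ → Matrix (Fin m) (Fin r) ℝ,
      IsDescentPath Finset.univ X U₀ U ∧ IsGrassmannGeodesic U := by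
  obtain ⟨P, hP, C, hXC⟩ := exists_stiefel_mul X hX
  obtain ⟨Y, Z, W, e, θ, hY, hZ, hUW, hW, he, hθ, hPZ⟩ := exists_principal_angles hU₀ hP
  have hU₀' : U₀ᵀ * U₀ = 1 := hU₀
  have hA : (U₀ * Y)ᵀ * (U₀ * Y) = 1 := by
    rw [transpose_mul, Matrix.mul_assoc, ← Matrix.mul_assoc U₀ᵀ, hU₀', Matrix.one_mul, hY]
  have hAW : (U₀ * Y)ᵀ * W = 0 := by
    rw [transpose_mul, Matrix.mul_assoc, hUW, Matrix.mul_zero]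
  -- The curve ends at `P Z Yᵀ`, which has the same column space as `P`; the factor `Y Zᵀ` undoes
  -- the rotation.
  have hend : angleCurve (U₀ * Y) W Y θ 1 * (Y * Zᵀ * C) = X := by
    simp only [angleCurve, one_mul, bend]
    rw [← hPZ, hXC, Matrix.mul_assoc Y, Matrix.mul_assoc (P * Z), ← Matrix.mul_assoc Yᵀ, hY,
      Matrix.one_mul, Matrix.mul_assoc P, ← Matrix.mul_assoc Z, mul_eq_one_comm.1 hZ,
      Matrix.one_mul]
  have hstart : angleCurve (U₀ * Y) W Y θ 0 = U₀ := by
    simp [angleCurve, bend, Matrix.mul_assoc, mul_eq_one_comm.1 hY]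
  have hmem := angleCurve_mem_stiefel hA hAW hW he hY
  obtain ⟨β, hβ, hobj⟩ := geomObjective_angleCurve hA hAW hW he hY X _ hend.symm
  have hzero : U₀ ∈ geomZeroSet r Finset.univ X ↔ ∀ j, β j = 0 ∨ θ j = 0 := by
    have h1 : U₀ ∈ geomZeroSet r Finset.univ X ↔ ∑ j, β j * Real.sin (θ j) ^ 2 = 0 := by
      rw [geomZeroSet, Set.mem_ofPred_eq, and_iff_right hU₀, ← hstart, hobj]
      simp
    rw [h1, Finset.sum_eq_zero_iff_of_nonneg fun j _ => mul_nonneg (hβ j) (sq_nonneg _)]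
    simp only [Finset.mem_univ, true_imp_iff, mul_eq_zero, pow_eq_zero_iff two_ne_zero]
    refine forall_congr' fun j => or_congr_right ?_
    exact Real.sin_eq_zero_iff_of_lt_of_lt (by linarith [(hθ j).1, Real.pi_pos])
      (by linarith [(hθ j).2, Real.pi_pos])
  refine ⟨_, ⟨continuous_angleCurve.continuousOn, fun t _ => hmem t, hstart, ⟨hmem 1, ?_⟩, ?_⟩,
    isGrassmannGeodesic_angleCurve hA hAW hW he hY⟩
  · rw [hobj]
    simp
  intro t ht
  have hpos : ∀ j, θ j = 0 ∨
      0 < 2 * θ j * Real.sin ((1 - t) * θ j) * Real.cos ((1 - t) * θ j) := by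
    intro j
    rcases (hθ j).1.eq_or_lt with h | h
    · exact Or.inl h.symm
    right
    have h1 : 0 < (1 - t) * θ j := mul_pos (sub_pos.2 ht.2) h
    -- Strict because `t > 0`, even when `θ j = π / 2`, so the cosine stays positive.
    have h2 : (1 - t) * θ j < Real.pi / 2 := by nlinarith [ht.1, (hθ j).2]
    have h3 := Real.sin_pos_of_pos_of_lt_pi h1 (by linarith)
    have h4 := Real.cos_pos_of_mem_Ioo ⟨by linarith, h2⟩
    positivity
  have hterm : ∀ j, 0 ≤ β j * (2 * θ j * Real.sin ((1 - t) * θ j) * Real.cos ((1 - t) * θ j)) :=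
    fun j => mul_nonneg (hβ j) <| (hpos j).elim (fun h => by simp [h]) le_of_lt
  refine ⟨_, (funext hobj : (fun s => geomObjective _ _ _) = _) ▸ hasDerivAt_sum_mul_sin_sq β θ t,
    neg_nonpos.2 (Finset.sum_nonneg fun j _ => hterm j), ?_⟩
  rw [hzero, neg_eq_zero, Finset.sum_eq_zero_iff_of_nonneg fun j _ => hterm j]
  simp only [Finset.mem_univ, true_imp_iff]
  refine forall_congr' fun j => ⟨fun h => ?_, fun h => ?_⟩
  · rcases hpos j with h0 | h0
    · exact Or.inr h0
    · exact Or.inl ((mul_eq_zero.1 h).resolve_right h0.ne')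
  · rcases h with h | h <;> simp [h]

theorem theorem2 (m n r : ℕ) (X : Matrix (Fin m) (Fin n) ℝ) (hr : X.rank = r)
    (Ω : Finset (Fin m × Fin n)) :
    (r = 1 →
      ∀ᵐ U₀ ∂(isotropicMeasure (hr ▸ X.rank_le_height : r ≤ m)),
        ∃ U : ℝ → Matrix (Fin m) (Fin r) ℝ,
          IsDescentPath Ω X U₀.1 U ∧ IsNormalizedInterpolation U) ∧
    (Ω = Finset.univ →
      ∀ᵐ U₀ ∂(isotropicMeasure (hr ▸ X.rank_le_height : r ≤ m)),
        ∃ U : ℝ → Matrix (Fin m) (Fin r) ℝ,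
          IsDescentPath Ω X U₀.1 U ∧ IsGrassmannGeodesic U) := by
  refine ⟨fun h1 => ?_, fun hΩ => ?_⟩
  · subst h1
    -- The path exists from every starting point, so no null set is excluded.
    exact Filter.Eventually.of_forall fun U₀ =>
      exists_descent_interpolation_of_rank_eq_one Ω X hr U₀.2
  · subst hΩ
    exact Filter.Eventually.of_forall fun U₀ => exists_descent_geodesic X hr U₀.2
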